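/- Let $(M,g)$ be a semi-Riemannian manifold with Levi-Civita connection $\overline\nabla$, and let $\sigma\subset \mathrm{End}(TM)$ be an almost paraquaternionic structure, i.e. a rank-3 subbundle which near every point has a smooth local basis $\{J_1,J_2,J_3\}$ (a canonical local basis) with $$J_\alpha^2=-\epsilon_\alpha\,\mathrm{Id},\qquad J_\alpha J_{\alpha+1}=-J_{\alpha+1}J_\alpha=\epsilon_{\alpha+2}J_{\alpha+2},\qquad \epsilon_1=1,\ \epsilon_2=\epsilon_3=-1,$$ indices modulo 3. Suppose that $(M,\sigma,g)$ is a paraquaternionic Kähler manifold: $g(J_\alpha X,J_\alpha Y)=\epsilon_\alpha g(X,Y)$ for every canonical local basis, and $\sigma$ is parallel with respect to $\overline\nabla$. Let $N$ be a paraquaternionic CR-submanifold of $M$: an immersed submanifold on which the induced metric (again denoted $g$) is non-degenerate, with a smooth distribution $\mathcal D\subseteq TN$, non-degenerate for $g$, such that for every canonical local basis $\{J_\alpha\}$ and every point $x$ of $N$ in its domain $$J_\alpha\mathcal D_x=\mathcal D_x,\qquad J_\alpha\mathcal D_x^\perp\subseteq T_xN^\perp\qquad(\alpha=1,2,3),$$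 where $\mathcal D^\perp$ is the orthogonal complement of $\mathcal D$ in $TN$. Let $\nabla$ be the Levi-Civita connection of $N$, and for local sections $X,Y$ of $\mathcal D$ let $h^{\mathcal D}(X,Y)$ be the $\mathcal D^\perp$-component of $\nabla_XY$. Then $\mathcal D$ is minimal, i.e. its mean curvature vector $$H^{\mathcal D}=\frac1q\sum_{i=1}^q g(E_i,E_i)\,h^{\mathcal D}(E_i,E_i),\qquad q=\dim\mathcal D,\quad \{E_i\}\text{ a pseudo-orthonormal basis of }\mathcal D,$$ vanishes identically (for $q=0$ we put $H^{\mathcal D}=0$). Moreover $h^{\mathcal D}(X,X)=0$ for every local section $X$ of $\mathcal D$. -/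

import Mathlib

open Bundle VectorField Module
open scoped Manifold ContDiff Topology

noncomputable section

section Metric

variable {E : Type*} [NormedAddCommGroup E] [NormedSpace ℝ E]
  {M : Type*} [TopologicalSpace M] [ChartedSpace E M] [IsManifold 𝓘(ℝ, E) ∞ M]

variable (E M) in
/-- A semi-Riemannian metric: a smooth field of nondegenerate symmetric bilinear forms. -/
structure SemiRiemannianMetric where
  inner (x : M) : TangentSpace 𝓘(ℝ, E) x →L[ℝ] TangentSpace 𝓘(ℝ, E) x →L[ℝ] ℝ
  symm (x : M) (v w : TangentSpace 𝓘(ℝ, E) x) : inner x v w = inner x w v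
  nondegenerate (x : M) (v : TangentSpace 𝓘(ℝ, E) x) (hv : ∀ w, inner x v w = 0) : v = 0
  contMDiff : ContMDiff 𝓘(ℝ, E) (𝓘(ℝ, E).prod 𝓘(ℝ, E →L[ℝ] E →L[ℝ] ℝ)) ∞
    (fun x ↦ TotalSpace.mk' (E →L[ℝ] E →L[ℝ] ℝ)
      (E := fun x : M ↦ TangentSpace 𝓘(ℝ, E) x →L[ℝ] TangentSpace 𝓘(ℝ, E) x →L[ℝ] ℝ) x (inner x))

/-- A connection is a Levi-Civita connection of `g` if it is metric and torsion free. -/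
structure IsLeviCivita (g : SemiRiemannianMetric E M)
    (cov : CovariantDerivative 𝓘(ℝ, E) E (TangentSpace 𝓘(ℝ, E) : M → Type _)) : Prop where
  metric {x : M} {Y Z : Π x : M, TangentSpace 𝓘(ℝ, E) x} (v : TangentSpace 𝓘(ℝ, E) x)
    (hY : MDiffAt (T% Y) x) (hZ : MDiffAt (T% Z) x) :
    d% (fun y ↦ g.inner y (Y y) (Z y)) x v =
      g.inner x (cov Y x v) (Z x) + g.inner x (Y x) (cov Z x v)
  torsionFree {x : M} {X Y : Π x : M, TangentSpace 𝓘(ℝ, E) x}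
    (hX : MDiffAt (T% X) x) (hY : MDiffAt (T% Y) x) :
    cov Y x (X x) - cov X x (Y x) = mlieBracket 𝓘(ℝ, E) X Y x

variable (g : SemiRiemannianMetric E M)

namespace SemiRiemannianMetric

theorem mdifferentiableAt_inner {x : M} {Y Z : Π x : M, TangentSpace 𝓘(ℝ, E) x}
    (hY : MDiffAt (T% Y) x) (hZ : MDiffAt (T% Z) x) :
    MDiffAt (fun y ↦ g.inner y (Y y) (Z y)) x := by
  have h1 := (g.contMDiff x).mdifferentiableAt (by simp)
  have : MDifferentiableAt 𝓘(ℝ, E) (𝓘(ℝ, E).prod 𝓘(ℝ))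
      (fun m ↦ TotalSpace.mk' ℝ (E := Bundle.Trivial M ℝ) m (g.inner m (Y m) (Z m))) x := by
    apply MDifferentiableAt.clm_bundle_apply₂ (F₁ := E) (F₂ := E)
    · exact h1
    · exact hY
    · exact hZ
  rw [mdifferentiableAt_totalSpace] at this
  exact this.2

theorem inner_right_injective {x : M} {u v : TangentSpace 𝓘(ℝ, E) x}
    (h : ∀ w, g.inner x u w = g.inner x v w) : u = v := by
  rw [← sub_eq_zero]
  apply g.nondegenerate x
  intro w
  simp [h]

/-- The metric at a point as a bilinear form. -/
def bilin (x : M) : LinearMap.BilinForm ℝ (TangentSpace 𝓘(ℝ, E) x) :=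
  LinearMap.mk₂ ℝ (fun v w ↦ g.inner x v w) (by simp) (by simp) (by simp) (by simp)

@[simp]
theorem bilin_apply (x : M) (v w : TangentSpace 𝓘(ℝ, E) x) : g.bilin x v w = g.inner x v w := rfl

theorem bilin_isSymm (x : M) : (g.bilin x).IsSymm := ⟨fun v w ↦ g.symm x v w⟩

/-- The Koszul expression, equal to `2 g(∇_X Y, Z)` for the Levi-Civita connection `∇`. -/
def koszul (X Y Z : Π x : M, TangentSpace 𝓘(ℝ, E) x) (x : M) : ℝ :=
  d% (fun y ↦ g.inner y (Y y) (Z y)) x (X x) + d% (fun y ↦ g.inner y (X y) (Z y)) x (Y x)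
    - d% (fun y ↦ g.inner y (X y) (Y y)) x (Z x)
    + g.inner x (mlieBracket 𝓘(ℝ, E) X Y x) (Z x) - g.inner x (mlieBracket 𝓘(ℝ, E) X Z x) (Y x)
    - g.inner x (mlieBracket 𝓘(ℝ, E) Y Z x) (X x)

section aux
variable {x : M} {X X' Y Y' Z : Π x : M, TangentSpace 𝓘(ℝ, E) x} {f : M → ℝ}

theorem mvfderiv_inner_smul_left (hf : MDiffAt f x) (hX : MDiffAt (T% X) x)
    (hY : MDiffAt (T% Y) x) (v : TangentSpace 𝓘(ℝ, E) x) :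
    d% (fun y ↦ g.inner y ((f • X) y) (Y y)) x v =
      f x * d% (fun y ↦ g.inner y (X y) (Y y)) x v + d% f x v * g.inner x (X x) (Y x) := by
  have : (fun y ↦ g.inner y ((f • X) y) (Y y)) = f * (fun y ↦ g.inner y (X y) (Y y)) := by
    ext y; simp
  rw [this, mvfderiv_mul hf (g.mdifferentiableAt_inner hX hY)]
  simp [mul_comm]

theorem mvfderiv_inner_smul_right (hf : MDiffAt f x) (hX : MDiffAt (T% X) x)
    (hY : MDiffAt (T% Y) x) (v : TangentSpace 𝓘(ℝ, E) x) :
    d% (fun y ↦ g.inner y (X y) ((f • Y) y)) x v =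
      f x * d% (fun y ↦ g.inner y (X y) (Y y)) x v + d% f x v * g.inner x (X x) (Y x) := by
  have : (fun y ↦ g.inner y (X y) ((f • Y) y)) = f * (fun y ↦ g.inner y (X y) (Y y)) := by
    ext y; simp
  rw [this, mvfderiv_mul hf (g.mdifferentiableAt_inner hX hY)]
  simp [mul_comm]

theorem mvfderiv_inner_add_left (hX : MDiffAt (T% X) x) (hX' : MDiffAt (T% X') x)
    (hY : MDiffAt (T% Y) x) (v : TangentSpace 𝓘(ℝ, E) x) :
    d% (fun y ↦ g.inner y ((X + X') y) (Y y)) x v =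
      d% (fun y ↦ g.inner y (X y) (Y y)) x v + d% (fun y ↦ g.inner y (X' y) (Y y)) x v := by
  have : (fun y ↦ g.inner y ((X + X') y) (Y y)) =
      (fun y ↦ g.inner y (X y) (Y y)) + (fun y ↦ g.inner y (X' y) (Y y)) := by
    ext y; simp
  rw [this, mvfderiv_add (g.mdifferentiableAt_inner hX hY) (g.mdifferentiableAt_inner hX' hY)]
  simp

theorem mvfderiv_inner_add_right (hX : MDiffAt (T% X) x) (hX' : MDiffAt (T% X') x)
    (hY : MDiffAt (T% Y) x) (v : TangentSpace 𝓘(ℝ, E) x) :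
    d% (fun y ↦ g.inner y (Y y) ((X + X') y)) x v =
      d% (fun y ↦ g.inner y (Y y) (X y)) x v + d% (fun y ↦ g.inner y (Y y) (X' y)) x v := by
  have : (fun y ↦ g.inner y (Y y) ((X + X') y)) =
      (fun y ↦ g.inner y (Y y) (X y)) + (fun y ↦ g.inner y (Y y) (X' y)) := by
    ext y; simp
  rw [this, mvfderiv_add (g.mdifferentiableAt_inner hY hX) (g.mdifferentiableAt_inner hY hX')]
  simp

variable [FiniteDimensional ℝ E]

theorem tensorialAt_koszul_left (hY : MDiffAt (T% Y) x) (hZ : MDiffAt (T% Z) x) :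
    TensorialAt 𝓘(ℝ, E) E (fun X ↦ g.koszul X Y Z x) x := by
  have : CompleteSpace E := FiniteDimensional.complete ℝ E
  constructor
  · intro f X hf hX
    simp only [koszul, g.mvfderiv_inner_smul_left hf hX hZ, g.mvfderiv_inner_smul_left hf hX hY,
      mlieBracket_smul_left hf hX]
    simp
    ring
  · intro X X' hX hX'
    simp only [koszul, g.mvfderiv_inner_add_left hX hX' hZ, g.mvfderiv_inner_add_left hX hX' hY,
      mlieBracket_add_left hX hX']
    simp
    ring

theorem tensorialAt_koszul_right (hX : MDiffAt (T% X) x) (hY : MDiffAt (T% Y) x) :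
    TensorialAt 𝓘(ℝ, E) E (fun Z ↦ g.koszul X Y Z x) x := by
  have : CompleteSpace E := FiniteDimensional.complete ℝ E
  constructor
  · intro f Z hf hZ
    simp only [koszul, g.mvfderiv_inner_smul_right hf hX hZ, g.mvfderiv_inner_smul_right hf hY hZ,
      mlieBracket_smul_right hf hZ]
    simp
    rw [g.symm x (Y x) (Z x), g.symm x (Z x) (X x)]
    ring
  · intro Z Z' hZ hZ'
    simp only [koszul, g.mvfderiv_inner_add_right hZ hZ' hX, g.mvfderiv_inner_add_right hZ hZ' hY,
      mlieBracket_add_right hZ hZ']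
    simp
    ring

theorem koszul_add (hX : MDiffAt (T% X) x) (hY : MDiffAt (T% Y) x) (hY' : MDiffAt (T% Y') x)
    (hZ : MDiffAt (T% Z) x) :
    g.koszul X (Y + Y') Z x = g.koszul X Y Z x + g.koszul X Y' Z x := by
  have : CompleteSpace E := FiniteDimensional.complete ℝ E
  simp only [koszul, g.mvfderiv_inner_add_right hY hY' hX, g.mvfderiv_inner_add_left hY hY' hZ,
      mlieBracket_add_right hY hY', mlieBracket_add_left hY hY']
  simp
  ring

theorem koszul_smul (hf : MDiffAt f x) (hX : MDiffAt (T% X) x) (hY : MDiffAt (T% Y) x)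
    (hZ : MDiffAt (T% Z) x) :
    g.koszul X (f • Y) Z x =
      f x * g.koszul X Y Z x + 2 * (d% f x (X x) * g.inner x (Y x) (Z x)) := by
  have : CompleteSpace E := FiniteDimensional.complete ℝ E
  simp only [koszul, g.mvfderiv_inner_smul_right hf hX hY, g.mvfderiv_inner_smul_left hf hY hZ,
      mlieBracket_smul_right hf hY, mlieBracket_smul_left hf hY]
  simp
  rw [g.symm x (Y x) (X x)]
  ring

end aux

variable [FiniteDimensional ℝ E]

instance finiteDimensional_tangentSpace (x : M) :
    FiniteDimensional ℝ (TangentSpace 𝓘(ℝ, E) x) :=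
  inferInstanceAs (FiniteDimensional ℝ E)

theorem exists_inner_eq (x : M) (φ : TangentSpace 𝓘(ℝ, E) x →ₗ[ℝ] ℝ) :
    ∃ v, ∀ w, g.inner x v w = φ w := by
  let L : TangentSpace 𝓘(ℝ, E) x →ₗ[ℝ] Dual ℝ (TangentSpace 𝓘(ℝ, E) x) :=
    { toFun := fun v ↦ (g.inner x v : TangentSpace 𝓘(ℝ, E) x →ₗ[ℝ] ℝ)
      map_add' := fun v w ↦ by ext; simp
      map_smul' := fun c v ↦ by ext; simp }
  have hL : Function.Injective L := by
    rw [injective_iff_map_eq_zero]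
    intro v hv
    exact g.nondegenerate x v fun w ↦ congrArg (fun ψ : Dual ℝ _ ↦ ψ w) hv
  obtain ⟨v, hv⟩ := (LinearMap.injective_iff_surjective_of_finrank_eq_finrank
    (Subspace.dual_finrank_eq).symm).1 hL φ
  exact ⟨v, fun w ↦ congrArg (fun ψ : Dual ℝ _ ↦ ψ w) hv⟩

theorem exists_koszul_repr {x : M} {Y : Π x : M, TangentSpace 𝓘(ℝ, E) x}
    (hY : MDiffAt (T% Y) x) :
    ∃ L : TangentSpace 𝓘(ℝ, E) x →L[ℝ] TangentSpace 𝓘(ℝ, E) x,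
      ∀ X Z : Π x : M, TangentSpace 𝓘(ℝ, E) x, MDiffAt (T% X) x → MDiffAt (T% Z) x →
        2 * g.inner x (L (X x)) (Z x) = g.koszul X Y Z x := by
  let B := TensorialAt.mkHom₂ (I := 𝓘(ℝ, E)) (F := E) (F' := E) (fun X Z ↦ g.koszul X Y Z x) x
    (fun Z hZ ↦ g.tensorialAt_koszul_left hY hZ) (fun X hX ↦ g.tensorialAt_koszul_right hX hY)
  have hB : ∀ u : TangentSpace 𝓘(ℝ, E) x, ∃ v, ∀ w, g.inner x v w = B u w := fun u ↦
    g.exists_inner_eq x (B u)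
  choose s hs using hB
  let L : TangentSpace 𝓘(ℝ, E) x →ₗ[ℝ] TangentSpace 𝓘(ℝ, E) x :=
    { toFun := s
      map_add' := fun u v ↦ g.inner_right_injective fun w ↦ by simp [hs]
      map_smul' := fun c v ↦ g.inner_right_injective fun w ↦ by simp [hs] }
  have : T2Space (TangentSpace 𝓘(ℝ, E) x) := inferInstanceAs (T2Space E)
  refine ⟨(1 / 2 : ℝ) • LinearMap.toContinuousLinearMap L, fun X Z hX hZ ↦ ?_⟩
  have h1 : g.inner x (s (X x)) (Z x) = g.koszul X Y Z x := by
    rw [hs]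
    exact TensorialAt.mkHom₂_apply _ _ hX hZ
  rw [← h1]
  simp [L]

/-- The fundamental theorem of semi-Riemannian geometry, existence. -/
theorem exists_isLeviCivita :
    ∃ cov : CovariantDerivative 𝓘(ℝ, E) E (TangentSpace 𝓘(ℝ, E) : M → Type _),
      IsLeviCivita g cov := by
  classical
  have : CompleteSpace E := FiniteDimensional.complete ℝ E
  let c (Y : Π x : M, TangentSpace 𝓘(ℝ, E) x) (x : M) :
      TangentSpace 𝓘(ℝ, E) x →L[ℝ] TangentSpace 𝓘(ℝ, E) x :=
    if hY : MDiffAt (T% Y) x then (g.exists_koszul_repr hY).choose else 0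
  have hc {x : M} {X Y Z : Π x : M, TangentSpace 𝓘(ℝ, E) x} (hX : MDiffAt (T% X) x)
      (hY : MDiffAt (T% Y) x) (hZ : MDiffAt (T% Z) x) :
      2 * g.inner x (c Y x (X x)) (Z x) = g.koszul X Y Z x := by
    simp only [c, hY, dif_pos]
    exact (g.exists_koszul_repr hY).choose_spec X Z hX hZ
  have hext {x : M} (v : TangentSpace 𝓘(ℝ, E) x) :
      ∃ X : Π x : M, TangentSpace 𝓘(ℝ, E) x, MDiffAt (T% X) x ∧ X x = v :=
    ⟨FiberBundle.extend E v, FiberBundle.mdifferentiableAt_extend .., by simp⟩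
  refine ⟨⟨c, ?_, ?_⟩, ?_, ?_⟩
  · intro Y Y' x hY hY' _
    ext v
    apply g.inner_right_injective
    intro w
    obtain ⟨X, hX, rfl⟩ := hext v
    obtain ⟨Z, hZ, rfl⟩ := hext w
    have h := hc hX (mdifferentiableAt_add_section hY hY') hZ
    rw [g.koszul_add hX hY hY' hZ, ← hc hX hY hZ, ← hc hX hY' hZ] at h
    simp only [add_apply, map_add]
    linarith
  · intro Y f x hY hf _
    ext v
    apply g.inner_right_injective
    intro w
    obtain ⟨X, hX, rfl⟩ := hext v
    obtain ⟨Z, hZ, rfl⟩ := hext w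
    have h := hc hX (hf.smul_section hY) hZ
    rw [g.koszul_smul hf hX hY hZ, ← hc hX hY hZ] at h
    simp only [add_apply, map_add, ContinuousLinearMap.smulRight_apply, map_smul, smul_apply,
      smul_eq_mul]
    linarith
  · intro x Y Z v hY hZ
    obtain ⟨X, hX, rfl⟩ := hext v
    have h1 := hc hX hY hZ
    have h2 := hc hX hZ hY
    have h3 : g.inner x (Y x) (c Z x (X x)) = g.inner x (c Z x (X x)) (Y x) := g.symm ..
    change _ = g.inner x (c Y x (X x)) (Z x) + g.inner x (Y x) (c Z x (X x))
    rw [h3]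
    simp only [koszul] at h1 h2
    have e : (fun y ↦ g.inner y (Z y) (Y y)) = (fun y ↦ g.inner y (Y y) (Z y)) := by
      ext y; exact g.symm ..
    rw [e, mlieBracket_swap_apply (V := Z) (W := Y)] at h2
    simp only [map_neg, neg_apply] at h2
    linarith
  · intro x X Y hX hY
    apply g.inner_right_injective
    intro w
    obtain ⟨Z, hZ, rfl⟩ := hext w
    have h1 := hc hX hY hZ
    have h2 := hc hY hX hZ
    change g.inner x (c Y x (X x) - c X x (Y x)) (Z x) = _
    simp only [koszul] at h1 h2
    have e : (fun y ↦ g.inner y (Y y) (X y)) = (fun y ↦ g.inner y (X y) (Y y)) := by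
      ext y; exact g.symm ..
    rw [e, mlieBracket_swap_apply (V := Y) (W := X)] at h2
    simp only [map_neg, map_sub, neg_apply, sub_apply] at h2 ⊢
    linarith

/-- The Levi-Civita connection of a semi-Riemannian metric. -/
def leviCivita : CovariantDerivative 𝓘(ℝ, E) E (TangentSpace 𝓘(ℝ, E) : M → Type _) :=
  g.exists_isLeviCivita.choose

theorem isLeviCivita_leviCivita : IsLeviCivita g g.leviCivita :=
  g.exists_isLeviCivita.choose_spec

/-- The fundamental theorem of semi-Riemannian geometry, uniqueness. -/
theorem eq_leviCivita {cov : CovariantDerivative 𝓘(ℝ, E) E (TangentSpace 𝓘(ℝ, E) : M → Type _)}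
    (h : IsLeviCivita g cov) {x : M} {Y : Π x : M, TangentSpace 𝓘(ℝ, E) x}
    (hY : MDiffAt (T% Y) x) : cov Y x = g.leviCivita Y x := by
  have key {cov : CovariantDerivative 𝓘(ℝ, E) E (TangentSpace 𝓘(ℝ, E) : M → Type _)}
      (h : IsLeviCivita g cov) {X Z : Π x : M, TangentSpace 𝓘(ℝ, E) x} (hX : MDiffAt (T% X) x)
      (hZ : MDiffAt (T% Z) x) : 2 * g.inner x (cov Y x (X x)) (Z x) = g.koszul X Y Z x := by
    rw [koszul, h.metric _ hY hZ, h.metric _ hX hZ, h.metric _ hX hY, ← h.torsionFree hX hY,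
      ← h.torsionFree hX hZ, ← h.torsionFree hY hZ]
    simp only [map_sub, sub_apply]
    rw [g.symm x (Y x), g.symm x (X x) (cov Z x _), g.symm x (X x) (cov Y x _)]
    ring
  ext v
  apply g.inner_right_injective
  intro w
  have hX := FiberBundle.mdifferentiableAt_extend (I := 𝓘(ℝ, E)) (F := E) v
  have hZ := FiberBundle.mdifferentiableAt_extend (I := 𝓘(ℝ, E)) (F := E) w
  have h1 := key h hX hZ
  have h2 := key g.isLeviCivita_leviCivita hX hZ
  simp only [FiberBundle.extend_apply_self] at h1 h2
  linarith

end SemiRiemannianMetric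

/-! ### Distributions -/

variable (E M) in
/-- A smooth distribution: near every point it is spanned by pointwise linearly independent smooth
vector fields. -/
structure TangentDistribution where
  fiber (x : M) : Submodule ℝ (TangentSpace 𝓘(ℝ, E) x)
  exists_frame (x₀ : M) : ∃ U : Set M, IsOpen U ∧ x₀ ∈ U ∧
    ∃ (q : ℕ) (X : Fin q → Π x : M, TangentSpace 𝓘(ℝ, E) x),
      (∀ i, CMDiff[U] ∞ (T% (X i))) ∧
      ∀ x ∈ U, LinearIndependent ℝ (fun i ↦ X i x) ∧
        fiber x = Submodule.span ℝ (Set.range fun i ↦ X i x)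

namespace TangentDistribution

variable (D : TangentDistribution E M)

/-- `X` is a smooth section of `D` over the set `U`. -/
structure IsSectionOn (U : Set M) (X : Π x : M, TangentSpace 𝓘(ℝ, E) x) : Prop where
  contMDiffOn : CMDiff[U] ∞ (T% X)
  mem (x : M) (hx : x ∈ U) : X x ∈ D.fiber x

/-- `D` is nondegenerate if the metric restricts to a nondegenerate form on each `D_x`. -/
def IsNondegenerate : Prop :=
  ∀ x, ∀ v ∈ D.fiber x, (∀ w ∈ D.fiber x, g.inner x v w = 0) → v = 0

/-- The orthogonal complement of `D_x` in the tangent space. -/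
def orthogonal (x : M) : Submodule ℝ (TangentSpace 𝓘(ℝ, E) x) :=
  (g.bilin x).orthogonal (D.fiber x)

theorem mem_orthogonal_iff {x : M} {v : TangentSpace 𝓘(ℝ, E) x} :
    v ∈ D.orthogonal g x ↔ ∀ w ∈ D.fiber x, g.inner x w v = 0 :=
  Iff.rfl

variable {g D}

theorem IsNondegenerate.restrict_nondegenerate (hD : D.IsNondegenerate g) (x : M) :
    ((g.bilin x).restrict (D.fiber x)).Nondegenerate := by
  constructor
  · rintro ⟨v, hv⟩ h
    exact Subtype.ext (hD x v hv fun w hw ↦ h ⟨w, hw⟩)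
  · rintro ⟨v, hv⟩ h
    exact Subtype.ext (hD x v hv fun w hw ↦ (g.symm x v w).trans (h ⟨w, hw⟩))

variable [FiniteDimensional ℝ E]

theorem IsNondegenerate.isCompl (hD : D.IsNondegenerate g) (x : M) :
    IsCompl (D.fiber x) (D.orthogonal g x) :=
  LinearMap.BilinForm.isCompl_orthogonal_of_restrict_nondegenerate
    (g.bilin_isSymm x).isRefl (hD.restrict_nondegenerate x)

/-- The second fundamental form `h(X, Y)` of a nondegenerate distribution: the component of
`∇_X Y` in the orthogonal complement of `D`. -/
def secondFundamentalForm (hD : D.IsNondegenerate g) (X Y : Π x : M, TangentSpace 𝓘(ℝ, E) x)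
    (x : M) : TangentSpace 𝓘(ℝ, E) x :=
  (D.orthogonal g x).projection (D.fiber x) (hD.isCompl x).symm (g.leviCivita Y x (X x))

variable (g D) in
/-- `e` is a pseudo-orthonormal basis of `D_x`. -/
structure IsPseudoOrthonormalBasis (x : M) {q : ℕ} (e : Fin q → TangentSpace 𝓘(ℝ, E) x) :
    Prop where
  orthogonal (i j : Fin q) (hij : i ≠ j) : g.inner x (e i) (e j) = 0
  unit (i : Fin q) : g.inner x (e i) (e i) = 1 ∨ g.inner x (e i) (e i) = -1
  span_eq : Submodule.span ℝ (Set.range e) = D.fiber x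

/-- The mean curvature vector of `D` at `x`, computed with sections `e₁, …, e_q` of `D` which form
a pseudo-orthonormal basis of `D_x`. -/
def meanCurvatureVector (hD : D.IsNondegenerate g) {q : ℕ}
    (e : Fin q → Π x : M, TangentSpace 𝓘(ℝ, E) x) (x : M) : TangentSpace 𝓘(ℝ, E) x :=
  (1 / (q : ℝ)) • ∑ i, g.inner x (e i x) (e i x) • secondFundamentalForm hD (e i) (e i) x

/-- A nondegenerate distribution is minimal if its mean curvature vector vanishes identically.
As the second fundamental form is tensorial on sections of `D`, it does not matter by which
sections of `D` a pseudo-orthonormal basis of `D_x` is extended. -/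
def IsMinimal (hD : D.IsNondegenerate g) : Prop :=
  ∀ (x : M) (U : Set M), IsOpen U → x ∈ U →
    ∀ (q : ℕ) (e : Fin q → Π x : M, TangentSpace 𝓘(ℝ, E) x),
      (∀ i, D.IsSectionOn U (e i)) → D.IsPseudoOrthonormalBasis g x (fun i ↦ e i x) →
        meanCurvatureVector hD e x = 0

/-- Sections as in the definition of the mean curvature vector exist around every point. -/
theorem IsNondegenerate.exists_pseudoOrthonormal (hD : D.IsNondegenerate g) (x : M) :
    ∃ U : Set M, IsOpen U ∧ x ∈ U ∧
      ∃ (q : ℕ) (e : Fin q → Π x : M, TangentSpace 𝓘(ℝ, E) x),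
        (∀ i, D.IsSectionOn U (e i)) ∧ D.IsPseudoOrthonormalBasis g x (fun i ↦ e i x) := by
  obtain ⟨U, hU, hx, k, X, hX, hfr⟩ := D.exists_frame x
  refine ⟨U, hU, hx, finrank ℝ (D.fiber x), ?_⟩
  let B := (g.bilin x).restrict (D.fiber x)
  have : Invertible (2 : ℝ) := invertibleOfNonzero two_ne_zero
  have hBs : LinearMap.IsSymm B := ⟨fun v w ↦ g.symm x v w⟩
  obtain ⟨v, hv⟩ := LinearMap.BilinForm.exists_orthogonal_basis (B := B) hBs
  have hne (i) : B (v i) (v i) ≠ 0 := fun h ↦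
    hv.not_isOrtho_basis_self_of_separatingLeft (hD.restrict_nondegenerate x).1 i h
  let r (i) : ℝ := (Real.sqrt |B (v i) (v i)|)⁻¹
  have hr (i) : r i ≠ 0 := inv_ne_zero (Real.sqrt_ne_zero'.2 (abs_pos.2 (hne i)))
  have hr2 (i) : r i * r i * |B (v i) (v i)| = 1 := by
    have := Real.mul_self_sqrt (abs_nonneg (B (v i) (v i)))
    have h0 : |B (v i) (v i)| ≠ 0 := abs_ne_zero.2 (hne i)
    simp only [r]
    rw [← mul_inv, this, inv_mul_cancel₀ h0]
  have hmem (i) : ∃ c : Fin k → ℝ, ∑ j, c j • X j x = r i • (v i : TangentSpace 𝓘(ℝ, E) x) := by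
    have h : r i • (v i : TangentSpace 𝓘(ℝ, E) x) ∈ D.fiber x := (D.fiber x).smul_mem _ (v i).2
    exact (Submodule.mem_span_range_iff_exists_fun ℝ).1 ((hfr x hx).2.le h)
  choose c hc using hmem
  refine ⟨fun i y ↦ ∑ j, c i j • X j y, fun i ↦ ⟨?_, fun y hy ↦ ?_⟩, ?_, ?_, ?_⟩
  · have := ContMDiffOn.sum_section (I := 𝓘(ℝ, E)) (F := E) (V := (TangentSpace 𝓘(ℝ, E) : M → Type _))
      (s := Finset.univ) (t := fun j y ↦ c i j • X j y)
      (fun j _ ↦ (contMDiffOn_const (c := c i j)).smul_section (hX j))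
    exact this
  · rw [(hfr y hy).2]
    exact Submodule.sum_mem _ fun j _ ↦ Submodule.smul_mem _ _ (Submodule.subset_span ⟨j, rfl⟩)
  · intro i j hij
    have h : g.inner x (v i) (v j) = 0 := hv hij
    simp only [hc]
    simp [h]
  · intro i
    simp only [hc]
    have h := hr2 i
    have h' : g.inner x (r i • (v i : TangentSpace 𝓘(ℝ, E) x)) (r i • (v i)) =
        r i * r i * B (v i) (v i) := by
      simp [B]
      ring
    rw [h']
    rcases abs_choice (B (v i) (v i)) with h1 | h1
    · left; rw [← h1]; exact h
    · right; rw [h1] at h; linarith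
  · simp only [hc]
    have h1 : Submodule.span ℝ (Set.range fun i ↦ r i • (v i : TangentSpace 𝓘(ℝ, E) x)) =
        Submodule.span ℝ (Set.range fun i ↦ (v i : TangentSpace 𝓘(ℝ, E) x)) := by
      apply le_antisymm <;> rw [Submodule.span_le] <;> rintro _ ⟨i, rfl⟩
      · exact Submodule.smul_mem _ _ (Submodule.subset_span ⟨i, rfl⟩)
      · have : (v i : TangentSpace 𝓘(ℝ, E) x) = (r i)⁻¹ • r i • (v i : TangentSpace 𝓘(ℝ, E) x) := by
          rw [smul_smul, inv_mul_cancel₀ (hr i), one_smul]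
        simp only [SetLike.mem_coe]
        rw [this]
        exact Submodule.smul_mem _ _ (Submodule.subset_span ⟨i, rfl⟩)
    rw [h1]
    have h2 := congrArg (Submodule.map (D.fiber x).subtype) v.span_eq
    rw [Submodule.map_span, ← Set.range_comp, Submodule.map_top, Submodule.range_subtype] at h2
    exact h2

end TangentDistribution

/-! ### Paraquaternionic structures -/

/-- The signs `ε₁ = 1`, `ε₂ = ε₃ = -1`. -/
def paraSign : Fin 3 → ℝ := ![1, -1, -1]

/-- `J₁, J₂, J₃` is a canonical local basis, over the set `U`, of the family `σ` of subspaces of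
the endomorphism bundle of the tangent bundle. -/
structure IsCanonicalLocalBasis
    (σ : Π x : M, Submodule ℝ (TangentSpace 𝓘(ℝ, E) x →L[ℝ] TangentSpace 𝓘(ℝ, E) x))
    (U : Set M) (J : Fin 3 → Π x : M, TangentSpace 𝓘(ℝ, E) x →L[ℝ] TangentSpace 𝓘(ℝ, E) x) :
    Prop where
  contMDiffOn (α : Fin 3) : ContMDiffOn 𝓘(ℝ, E) (𝓘(ℝ, E).prod 𝓘(ℝ, E →L[ℝ] E)) ∞
    (fun x ↦ TotalSpace.mk' (E →L[ℝ] E)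
      (E := fun x : M ↦ TangentSpace 𝓘(ℝ, E) x →L[ℝ] TangentSpace 𝓘(ℝ, E) x) x (J α x)) U
  sq (x : M) (hx : x ∈ U) (α : Fin 3) (v : TangentSpace 𝓘(ℝ, E) x) :
    J α x (J α x v) = -paraSign α • v
  mul (x : M) (hx : x ∈ U) (α : Fin 3) (v : TangentSpace 𝓘(ℝ, E) x) :
    J α x (J (α + 1) x v) = paraSign (α + 2) • J (α + 2) x v
  anticomm (x : M) (hx : x ∈ U) (α : Fin 3) (v : TangentSpace 𝓘(ℝ, E) x) :
    J (α + 1) x (J α x v) = -J α x (J (α + 1) x v)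
  span_eq (x : M) (hx : x ∈ U) : σ x = Submodule.span ℝ (Set.range fun α ↦ J α x)

variable (E M) in
/-- An almost paraquaternionic structure: a rank 3 subbundle of the endomorphism bundle of the
tangent bundle which admits canonical local bases. -/
structure AlmostParaquaternionicStructure where
  fiber (x : M) : Submodule ℝ (TangentSpace 𝓘(ℝ, E) x →L[ℝ] TangentSpace 𝓘(ℝ, E) x)
  finrank_fiber (x : M) : finrank ℝ (fiber x) = 3
  exists_basis (x₀ : M) : ∃ U : Set M, IsOpen U ∧ x₀ ∈ U ∧ ∃ J, IsCanonicalLocalBasis fiber U J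

/-- The metric `g` is adapted to `σ`: `g(J_α X, J_α Y) = ε_α g(X, Y)` for all canonical local
bases of `σ`. -/
def IsAdapted (g : SemiRiemannianMetric E M) (σ : AlmostParaquaternionicStructure E M) : Prop :=
  ∀ (U : Set M) (J : Fin 3 → Π x : M, TangentSpace 𝓘(ℝ, E) x →L[ℝ] TangentSpace 𝓘(ℝ, E) x),
    IsOpen U → IsCanonicalLocalBasis σ.fiber U J → ∀ x ∈ U, ∀ (α : Fin 3)
      (v w : TangentSpace 𝓘(ℝ, E) x), g.inner x (J α x v) (J α x w) = paraSign α * g.inner x v w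

/-- The bundle `σ` is parallel with respect to the connection `∇`: if `S` is a smooth section of
`σ` over an open set, then the covariant derivative `T = ∇_v S`, the endomorphism given by
`(∇_v S) Y = ∇_v (S Y) - S (∇_v Y)`, lies again in `σ`. -/
def IsParallel (cov : CovariantDerivative 𝓘(ℝ, E) E (TangentSpace 𝓘(ℝ, E) : M → Type _))
    (σ : AlmostParaquaternionicStructure E M) : Prop :=
  ∀ (U : Set M) (S : Π x : M, TangentSpace 𝓘(ℝ, E) x →L[ℝ] TangentSpace 𝓘(ℝ, E) x),
    IsOpen U → (∀ x ∈ U, S x ∈ σ.fiber x) →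
    ContMDiffOn 𝓘(ℝ, E) (𝓘(ℝ, E).prod 𝓘(ℝ, E →L[ℝ] E)) ∞
      (fun x ↦ TotalSpace.mk' (E →L[ℝ] E)
        (E := fun x : M ↦ TangentSpace 𝓘(ℝ, E) x →L[ℝ] TangentSpace 𝓘(ℝ, E) x) x (S x)) U →
    ∀ x ∈ U, ∀ v : TangentSpace 𝓘(ℝ, E) x, ∃ T ∈ σ.fiber x,
      ∀ Y : Π x : M, TangentSpace 𝓘(ℝ, E) x, MDiffAt (T% Y) x →
        T (Y x) = cov (fun y ↦ S y (Y y)) x v - S x (cov Y x v)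

/-- `(M, σ, g)` is a paraquaternionic Kähler manifold: `g` is adapted to `σ`, and `σ` is parallel
with respect to the Levi-Civita connection of `g`. -/
structure IsParaquaternionicKahler [FiniteDimensional ℝ E] (g : SemiRiemannianMetric E M)
    (σ : AlmostParaquaternionicStructure E M) : Prop where
  adapted : IsAdapted g σ
  parallel : IsParallel g.leviCivita σ

end Metric

section Submanifold

variable {E : Type*} [NormedAddCommGroup E] [NormedSpace ℝ E]
  {M : Type*} [TopologicalSpace M] [ChartedSpace E M] [IsManifold 𝓘(ℝ, E) ∞ M]
  {F : Type*} [NormedAddCommGroup F] [NormedSpace ℝ F]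
  {N : Type*} [TopologicalSpace N] [ChartedSpace F N]

/-- `f : N → M` is an immersion onto a nondegenerate submanifold of `(M, g)`. -/
structure IsNondegenerateImmersion (g : SemiRiemannianMetric E M) (f : N → M) : Prop where
  isImmersion : Manifold.IsImmersion 𝓘(ℝ, F) 𝓘(ℝ, E) ∞ f
  nondegenerate (x : N) (v : TangentSpace 𝓘(ℝ, F) x)
    (hv : ∀ w : TangentSpace 𝓘(ℝ, F) x, g.inner (f x)
      (mfderiv 𝓘(ℝ, F) 𝓘(ℝ, E) f x v) (mfderiv 𝓘(ℝ, F) 𝓘(ℝ, E) f x w) = 0) : v = 0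

/-- The pullback of the bilinear form `g` at `f x` by the derivative of `f` at `x`. -/
def pullbackInner (g : SemiRiemannianMetric E M) (f : N → M) (x : N) :
    TangentSpace 𝓘(ℝ, F) x →L[ℝ] TangentSpace 𝓘(ℝ, F) x →L[ℝ] ℝ :=
  (ContinuousLinearMap.precomp ℝ (mfderiv 𝓘(ℝ, F) 𝓘(ℝ, E) f x)) ∘L g.inner (f x) ∘L
    mfderiv 𝓘(ℝ, F) 𝓘(ℝ, E) f x

@[simp]
theorem pullbackInner_apply (g : SemiRiemannianMetric E M) (f : N → M) (x : N)
    (v w : TangentSpace 𝓘(ℝ, F) x) :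
    pullbackInner g f x v w = g.inner (f x) (mfderiv 𝓘(ℝ, F) 𝓘(ℝ, E) f x v)
      (mfderiv 𝓘(ℝ, F) 𝓘(ℝ, E) f x w) :=
  rfl

variable [IsManifold 𝓘(ℝ, F) ∞ N]

theorem contMDiff_pullbackInner (g : SemiRiemannianMetric E M) {f : N → M}
    (hf : ContMDiff 𝓘(ℝ, F) 𝓘(ℝ, E) ∞ f) :
    ContMDiff 𝓘(ℝ, F) (𝓘(ℝ, F).prod 𝓘(ℝ, F →L[ℝ] F →L[ℝ] ℝ)) ∞
      (fun x ↦ TotalSpace.mk' (F →L[ℝ] F →L[ℝ] ℝ)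
        (E := fun x : N ↦ TangentSpace 𝓘(ℝ, F) x →L[ℝ] TangentSpace 𝓘(ℝ, F) x →L[ℝ] ℝ) x
        (pullbackInner g f x)) := by
  intro x₀
  rw [contMDiffAt_hom_bundle]
  refine ⟨contMDiffAt_id, ?_⟩
  have hA : ContMDiffAt 𝓘(ℝ, F) 𝓘(ℝ, F →L[ℝ] E) ∞ _ x₀ := (hf x₀).mfderiv_const (m := ∞) (by simp)
  have hG := ((contMDiffAt_hom_bundle _).1 (g.contMDiff (f x₀))).2.comp x₀ (hf x₀)
  have hB := (hA.clm_precomp (F₃ := ℝ)).clm_comp (hG.clm_comp hA)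
  refine hB.congr_of_eventuallyEq ?_
  have A : ∀ᶠ x in 𝓝 x₀, x ∈ (trivializationAt F (TangentSpace 𝓘(ℝ, F)) x₀).baseSet :=
    (trivializationAt F (TangentSpace 𝓘(ℝ, F)) x₀).open_baseSet.mem_nhds
      (FiberBundle.mem_baseSet_trivializationAt' x₀)
  have A' : ∀ᶠ x in 𝓝 x₀, f x ∈ (trivializationAt E (TangentSpace 𝓘(ℝ, E)) (f x₀)).baseSet :=
    (hf x₀).continuousAt ((trivializationAt E (TangentSpace 𝓘(ℝ, E)) (f x₀)).open_baseSet.mem_nhds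
      (FiberBundle.mem_baseSet_trivializationAt' (f x₀)))
  filter_upwards [A, A'] with x hx hfx
  ext u v
  rw [inCoordinates_apply_eq₂ (E₃ := fun _ ↦ ℝ) hx hx (Set.mem_univ _)]
  simp only [ContinuousLinearMap.comp_apply, ContinuousLinearMap.precomp_apply, Function.comp_apply]
  rw [inCoordinates_apply_eq₂ (E₃ := fun _ ↦ ℝ) hfx hfx (Set.mem_univ _)]
  simp only [inTangentCoordinates, id]
  rw [ContinuousLinearMap.inCoordinates_eq hx hfx]
  have key (w : TangentSpace 𝓘(ℝ, E) (f x)) :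
      (trivializationAt E (TangentSpace 𝓘(ℝ, E)) (f x₀)).symm (f x)
        (trivializationAt E (TangentSpace 𝓘(ℝ, E)) (f x₀) ⟨f x, w⟩).2 = w :=
    Trivialization.symm_apply_apply_mk _ hfx w
  simp
  rw [key, key]

/-- The metric induced on a nondegenerate immersed submanifold. -/
def inducedMetric (g : SemiRiemannianMetric E M) {f : N → M}
    (hf : IsNondegenerateImmersion (F := F) g f) : SemiRiemannianMetric F N where
  inner x := pullbackInner g f x
  symm _ _ _ := g.symm _ _ _
  nondegenerate x v hv := hf.nondegenerate x v hv
  contMDiff := contMDiff_pullbackInner g hf.isImmersion.contMDiff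

/-- The immersed nondegenerate submanifold `f : N → M` of `(M, σ, g)` is a paraquaternionic
CR-submanifold with paraquaternionic distribution `D`. -/
structure IsParaquaternionicCRSubmanifold (g : SemiRiemannianMetric E M)
    (σ : AlmostParaquaternionicStructure E M) {f : N → M}
    (hf : IsNondegenerateImmersion (F := F) g f) (D : TangentDistribution F N) : Prop where
  nondegenerate : D.IsNondegenerate (inducedMetric g hf)
  paraquaternionic (U : Set M)
    (J : Fin 3 → Π x : M, TangentSpace 𝓘(ℝ, E) x →L[ℝ] TangentSpace 𝓘(ℝ, E) x)
    (hU : IsOpen U) (hJ : IsCanonicalLocalBasis σ.fiber U J) (x : N) (hx : f x ∈ U) (α : Fin 3) :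
    ((D.fiber x).map (mfderiv 𝓘(ℝ, F) 𝓘(ℝ, E) f x).toLinearMap).map (J α (f x)).toLinearMap =
      (D.fiber x).map (mfderiv 𝓘(ℝ, F) 𝓘(ℝ, E) f x).toLinearMap
  totallyReal (U : Set M)
    (J : Fin 3 → Π x : M, TangentSpace 𝓘(ℝ, E) x →L[ℝ] TangentSpace 𝓘(ℝ, E) x)
    (hU : IsOpen U) (hJ : IsCanonicalLocalBasis σ.fiber U J) (x : N) (hx : f x ∈ U) (α : Fin 3)
    (v : TangentSpace 𝓘(ℝ, F) x) (hv : v ∈ D.orthogonal (inducedMetric g hf) x)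
    (w : TangentSpace 𝓘(ℝ, F) x) :
    g.inner (f x) (J α (f x) (mfderiv 𝓘(ℝ, F) 𝓘(ℝ, E) f x v))
      (mfderiv 𝓘(ℝ, F) 𝓘(ℝ, E) f x w) = 0

end Submanifold

end

/-!
Let `X` be a section of `D` and `u ∈ D^⊥`. For each member `J_α` of a canonical local basis
`ε_α g(∇_X X, u) = g(J_α ∇_X X, J_α u) = g(∇_X (J_α X), J_α u) = g(∇_{J_α X} X, J_α u)`
`= -g(J_α ∇_{J_α X} X, u) = -g(∇_{J_α X} (J_α X), u)`,
where `∇` is the connection of the ambient manifold: as `σ` is parallel, `(∇J_α) X` stays in the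
image of `D`, which is orthogonal to `u` and to `J_α u`, and as `∇` is torsion-free, the arguments
can be exchanged because `[X, J_α X]` is tangent to the submanifold while `J_α u` is normal to it.
Writing `B X = g(∇_X X, u)`, this says `B (J_α X) = -ε_α B X`, hence `B (J₃ X) = B X`,
`B (J₂ J₃ X) = B (J₃ X)` and, since `J₂ J₃ = J₁`, also `B (J₁ X) = -B X`. So `B X = -B X`.

Vector fields on an immersed submanifold extend locally to the ambient manifold, and Lie brackets
of related vector fields are related. This justifies the exchange of arguments and, through the
Koszul formula, the Gauss formula, by which `g(∇_X X, u)` is the same for the induced connection.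
-/

section RelatedVectorFields

variable {𝕜 : Type*} [NontriviallyNormedField 𝕜]
  {E : Type*} [NormedAddCommGroup E] [NormedSpace 𝕜 E]
  {H : Type*} [TopologicalSpace H] {I : ModelWithCorners 𝕜 E H}
  {M : Type*} [TopologicalSpace M] [ChartedSpace H M]
  {E' : Type*} [NormedAddCommGroup E'] [NormedSpace 𝕜 E']
  {H' : Type*} [TopologicalSpace H'] {I' : ModelWithCorners 𝕜 E' H'}
  {M' : Type*} [TopologicalSpace M'] [ChartedSpace H' M']
  {G : Type*} [NormedAddCommGroup G] [NormedSpace 𝕜 G]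

theorem eventually_mdifferentiableAt_of_contMDiffAt [IsManifold I 1 M] [IsManifold I' 1 M']
    {f : M → M'} {x : M} (hf : ContMDiffAt I I' 1 f x) :
    ∀ᶠ y in 𝓝 x, MDifferentiableAt I I' f y :=
  ((contMDiffAt_iff_contMDiffAt_nhds (by simp)).1 hf).mono
    fun _ hy ↦ hy.mdifferentiableAt one_ne_zero

theorem mdifferentiableAt_mfderiv_along [IsManifold I' 1 M']
    {E'' : Type*} [NormedAddCommGroup E''] [NormedSpace 𝕜 E'']
    {H'' : Type*} [TopologicalSpace H''] {I'' : ModelWithCorners 𝕜 E'' H''}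
    {M'' : Type*} [TopologicalSpace M''] [ChartedSpace H'' M''] [IsManifold I'' 1 M'']
    {x : M} {f : M → M'} {h : M' → M''} {W : Π y : M, TangentSpace I' (f y)}
    (hh : ContMDiffAt I' I'' 2 h (f x))
    (hW : MDifferentiableAt I I'.tangent (fun y ↦ (⟨f y, W y⟩ : TangentBundle I' M')) x) :
    MDifferentiableAt I I''.tangent
      (fun y ↦ (⟨h (f y), mfderiv I' I'' h (f y) (W y)⟩ : TangentBundle I'' M'')) x := by
  have hf : MDifferentiableAt I I' f x := ((mdifferentiableAt_totalSpace _ _).1 hW).1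
  have hdh := ((hh.mfderiv_const (m := 1) (by norm_num)).mdifferentiableAt one_ne_zero).comp x hf
  exact MDifferentiableAt.clm_apply_of_inCoordinates (b₁ := f) (b₂ := h ∘ f) hdh hW
    ((hh.mdifferentiableAt two_ne_zero).comp x hf)

theorem mdifferentiableAt_mvfderiv_apply [IsManifold I 1 M] {x : M} {h : M → G}
    {V : Π y : M, TangentSpace I y} (hh : ContMDiffAt I 𝓘(𝕜, G) 2 h x) (hV : MDiffAt (T% V) x) :
    MDiffAt (fun y ↦ mvfderiv I h y (V y)) x :=
  ((contMDiff_snd_tangentBundle_modelSpace G 𝓘(𝕜, G)).mdifferentiable one_ne_zero _).comp x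
    (mdifferentiableAt_mfderiv_along (f := id) hh hV)

variable (I) in
/-- The coordinate expression of a vector field on a manifold in the preferred chart at `x₀`. -/
noncomputable def chartVectorField (x₀ : M) (V : Π y : M, TangentSpace I y) : E → E :=
  mpullbackWithin 𝓘(𝕜, E) I (extChartAt I x₀).symm V (Set.range I)

theorem mvfderiv_extChartAt_apply [IsManifold I 1 M] {x₀ y : M}
    (hy : y ∈ (extChartAt I x₀).source) (V : Π y : M, TangentSpace I y) :
    mvfderiv I (extChartAt I x₀) y (V y) = chartVectorField I x₀ V (extChartAt I x₀ y) := by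
  have hφy := (extChartAt I x₀).map_source hy
  refine ((isInvertible_mfderivWithin_extChartAt_symm hφy).inverse_apply_eq.2 ?_).symm
  rw [(extChartAt I x₀).left_inv hy]
  exact (DFunLike.congr_fun (mfderivWithin_extChartAt_symm_comp_mfderiv_extChartAt' hy) (V y)).symm

theorem mvfderiv_extChartAt_mlieBracket [IsManifold I 1 M] (x : M)
    (V W : Π y : M, TangentSpace I y) :
    mvfderiv I (extChartAt I x) x (mlieBracket I V W x) =
      lieBracketWithin 𝕜 (chartVectorField I x V) (chartVectorField I x W) (Set.range I)
        (extChartAt I x x) := by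
  rw [← mlieBracketWithin_univ, mlieBracketWithin_apply, Set.preimage_univ, Set.univ_inter]
  exact (isInvertible_mfderiv_extChartAt (mem_extChartAt_source x)).self_apply_inverse _

theorem differentiableWithinAt_chartVectorField [CompleteSpace E] [IsManifold I 2 M] {x : M}
    {V : Π y : M, TangentSpace I y} (hV : MDiffAt (T% V) x) :
    DifferentiableWithinAt 𝕜 (chartVectorField I x V) (Set.range I) (extChartAt I x x) := by
  have h := (mdifferentiableWithinAt_univ.2 hV).differentiableWithinAt_mpullbackWithin_vectorField
  rwa [Set.preimage_univ, Set.univ_inter] at h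

theorem mvfderiv_eq_fderivWithin_chart [IsManifold I 1 M] {h : M → G} {x₀ y : M}
    (hy : y ∈ (extChartAt I x₀).source) (hh : MDiffAt h y) (v : TangentSpace I y) :
    mvfderiv I h y v = fderivWithin 𝕜 (h ∘ (extChartAt I x₀).symm) (Set.range I)
      (extChartAt I x₀ y) (mvfderiv I (extChartAt I x₀) y v) := by
  have hφy := (extChartAt I x₀).map_source hy
  rw [← mfderivWithin_eq_fderivWithin,
    mfderiv_comp_mfderivWithin_of_eq hh (mdifferentiableWithinAt_extChartAt_symm hφy)
      (I.uniqueMDiffOn _ (extChartAt_target_subset_range x₀ hφy)) ((extChartAt I x₀).left_inv hy)]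
  exact (congrArg (mfderiv I 𝓘(𝕜, G) h y) (DFunLike.congr_fun
    (mfderivWithin_extChartAt_symm_comp_mfderiv_extChartAt' hy) v)).symm

theorem mvfderiv_comp_extChartAt_symm_eventuallyEq [IsManifold I 1 M] {h : M → G} {x : M}
    (hh : ∀ᶠ y in 𝓝 x, MDiffAt h y) (V : Π y : M, TangentSpace I y) :
    (fun y ↦ mvfderiv I h y (V y)) ∘ (extChartAt I x).symm
      =ᶠ[𝓝[Set.range I] extChartAt I x x]
        fun u ↦ fderivWithin 𝕜 (h ∘ (extChartAt I x).symm) (Set.range I) u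
          (chartVectorField I x V u) := by
  rw [← nhdsWithin_extChartAt_target_eq]
  have hcont : Filter.Tendsto (extChartAt I x).symm (𝓝[(extChartAt I x).target] extChartAt I x x)
      (𝓝 x) := by
    simpa using (continuousAt_extChartAt_symm (I := I) x).continuousWithinAt.tendsto
  filter_upwards [hcont.eventually hh, self_mem_nhdsWithin] with u hu hut
  have hus := (extChartAt I x).map_target hut
  rw [Function.comp_apply, mvfderiv_eq_fderivWithin_chart hus hu, mvfderiv_extChartAt_apply hus,
    (extChartAt I x).right_inv hut]

theorem mvfderiv_apply_mlieBracket [CompleteSpace E] [IsManifold I (minSmoothness 𝕜 2) M]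
    {h : M → G} {x : M} {V W : Π y : M, TangentSpace I y}
    (hh : ContMDiffAt I 𝓘(𝕜, G) (minSmoothness 𝕜 2) h x)
    (hV : MDiffAt (T% V) x) (hW : MDiffAt (T% W) x) :
    mvfderiv I h x (mlieBracket I V W x) =
      mvfderiv I (fun y ↦ mvfderiv I h y (W y)) x (V x) -
        mvfderiv I (fun y ↦ mvfderiv I h y (V y)) x (W x) := by
  have hx : x ∈ (extChartAt I x).source := mem_extChartAt_source x
  have hxr : extChartAt I x x ∈ Set.range I :=
    extChartAt_target_subset_range x (mem_extChartAt_target x)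
  have hh2 : ContMDiffAt I 𝓘(𝕜, G) 2 h x := hh.of_le le_minSmoothness
  have hhd : ∀ᶠ y in 𝓝 x, MDiffAt h y :=
    eventually_mdifferentiableAt_of_contMDiffAt (hh2.of_le one_le_two)
  have hsecond {Y Z : Π y : M, TangentSpace I y} (hZ : MDiffAt (T% Z) x) :
      mvfderiv I (fun y ↦ mvfderiv I h y (Z y)) x (Y x) = fderivWithin 𝕜
        (fun u ↦ fderivWithin 𝕜 (h ∘ (extChartAt I x).symm) (Set.range I) u
          (chartVectorField I x Z u))
          (Set.range I) (extChartAt I x x) (chartVectorField I x Y (extChartAt I x x)) := by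
    rw [mvfderiv_eq_fderivWithin_chart hx (mdifferentiableAt_mvfderiv_apply hh2 hZ),
      mvfderiv_extChartAt_apply hx,
      (mvfderiv_comp_extChartAt_symm_eventuallyEq hhd Z).fderivWithin_eq_of_mem hxr]
  rw [hsecond hV, hsecond hW, mvfderiv_eq_fderivWithin_chart hx hhd.self_of_nhds,
    mvfderiv_extChartAt_mlieBracket]
  exact fderivWithin_apply_lieBracket (contMDiffAt_iff_source.1 hh).contDiffWithinAt le_rfl
    I.uniqueDiffOn
    (I.range_subset_closure_interior hxr) hxr (differentiableWithinAt_chartVectorField hW)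
    (differentiableWithinAt_chartVectorField hV)

variable {f : M → M'} {x : M}

variable (I I') in
/-- Vector fields `V` and `V'` are `f`-related near `x`: the differential of `f` maps `V` to `V'`.
Unlike a pullback, this makes sense for maps that are not local diffeomorphisms. -/
def MRelatedAt (f : M → M') (V : Π y : M, TangentSpace I y) (V' : Π p : M', TangentSpace I' p)
    (x : M) : Prop :=
  ∀ᶠ y in 𝓝 x, mfderiv I I' f y (V y) = V' (f y)

variable {V W : Π y : M, TangentSpace I y} {V' W' : Π p : M', TangentSpace I' p}

theorem MRelatedAt.mfderiv_apply (hV : MRelatedAt I I' f V V' x) :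
    mfderiv I I' f x (V x) = V' (f x) :=
  hV.self_of_nhds

theorem MRelatedAt.mvfderiv_comp_apply (hV : MRelatedAt I I' f V V' x) {h : M' → G}
    (hh : MDiffAt h (f x)) (hf : MDifferentiableAt I I' f x) :
    mvfderiv I (h ∘ f) x (V x) = mvfderiv I' h (f x) (V' (f x)) := by
  rw [← hV.mfderiv_apply]
  exact DFunLike.congr_fun (mfderiv_comp x hh hf) (V x)

theorem MRelatedAt.mvfderiv_comp_eventuallyEq (hV : MRelatedAt I I' f V V' x) {h : M' → G}
    (hh : ∀ᶠ p in 𝓝 (f x), MDiffAt h p) (hf : ∀ᶠ y in 𝓝 x, MDifferentiableAt I I' f y) :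
    (fun y ↦ mvfderiv I (h ∘ f) y (V y)) =ᶠ[𝓝 x] (fun p ↦ mvfderiv I' h p (V' p)) ∘ f := by
  filter_upwards [hV.eventually_nhds, hf, hf.self_of_nhds.continuousAt.eventually hh]
    with y hVy hfy hhy
  exact MRelatedAt.mvfderiv_comp_apply hVy hhy hfy

theorem mfderiv_mlieBracket_of_mrelatedAt [CompleteSpace E] [CompleteSpace E']
    [IsManifold I (minSmoothness 𝕜 2) M] [IsManifold I' (minSmoothness 𝕜 2) M']
    (hf : ContMDiffAt I I' (minSmoothness 𝕜 2) f x)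
    (hV : MDiffAt (T% V) x) (hW : MDiffAt (T% W) x)
    (hV' : MDiffAt (T% V') (f x)) (hW' : MDiffAt (T% W') (f x))
    (hVV' : MRelatedAt I I' f V V' x) (hWW' : MRelatedAt I I' f W W' x) :
    mfderiv I I' f x (mlieBracket I V W x) = mlieBracket I' V' W' (f x) := by
  let ψ : M' → E' := ⇑(extChartAt I' (f x))
  have hψ : ContMDiffAt I' 𝓘(𝕜, E') (minSmoothness 𝕜 2) ψ (f x) := contMDiffAt_extChartAt
  have hψ2 : ContMDiffAt I' 𝓘(𝕜, E') 2 ψ (f x) := hψ.of_le le_minSmoothness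
  have hψd : ∀ᶠ p in 𝓝 (f x), MDiffAt ψ p :=
    eventually_mdifferentiableAt_of_contMDiffAt (hψ2.of_le one_le_two)
  have hfd : ∀ᶠ y in 𝓝 x, MDifferentiableAt I I' f y :=
    eventually_mdifferentiableAt_of_contMDiffAt (hf.of_le (one_le_two.trans le_minSmoothness))
  have hsecond {A B : Π y : M, TangentSpace I y} {A' B' : Π p : M', TangentSpace I' p}
      (hB' : MDiffAt (T% B') (f x)) (hA : MRelatedAt I I' f A A' x)
      (hB : MRelatedAt I I' f B B' x) :
      mvfderiv I (fun y ↦ mvfderiv I (ψ ∘ f) y (B y)) x (A x) =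
        mvfderiv I' (fun p ↦ mvfderiv I' ψ p (B' p)) (f x) (A' (f x)) := by
    rw [← hA.mvfderiv_comp_apply (mdifferentiableAt_mvfderiv_apply hψ2 hB') hfd.self_of_nhds]
    exact DFunLike.congr_fun (hB.mvfderiv_comp_eventuallyEq hψd hfd).mfderiv_eq (A x)
  apply (isInvertible_mfderiv_extChartAt (mem_extChartAt_source (I := I') (f x))).injective
  calc mvfderiv I' ψ (f x) (mfderiv I I' f x (mlieBracket I V W x))
      = mvfderiv I (ψ ∘ f) x (mlieBracket I V W x) :=
        (DFunLike.congr_fun (mfderiv_comp x hψd.self_of_nhds hfd.self_of_nhds) _).symm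
    _ = mvfderiv I' ψ (f x) (mlieBracket I' V' W' (f x)) := by
        rw [mvfderiv_apply_mlieBracket (hψ.comp x hf) hV hW,
          mvfderiv_apply_mlieBracket hψ hV' hW', hsecond hW' hVV' hWW', hsecond hV' hWW' hVV']

variable {n : ℕ∞ω}

theorem exists_leftInverse_of_isImmersionAt [I.Boundaryless]
    (hf : Manifold.IsImmersionAt I I' n f x) :
    ∃ r : M' → M, ContMDiffAt I' I n r (f x) ∧ ∀ᶠ y in 𝓝 x, r (f y) = y := by
  let φ := hf.domChart.extend I
  let ψ := hf.codChart.extend I'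
  let L : E' →L[𝕜] E := ContinuousLinearMap.fst 𝕜 E hf.complement ∘L
    (hf.equiv.symm : E' →L[𝕜] E × hf.complement)
  have hL {y : M} (hy : y ∈ φ.source) : L (ψ (f y)) = φ y := by
    have hwritten : ψ (f (φ.symm (φ y))) = hf.equiv (φ y, 0) :=
      hf.writtenInCharts (φ.map_source hy)
    rw [φ.left_inv hy] at hwritten
    simp [L, hwritten]
  have hx : φ.source ∈ 𝓝 x := hf.domChart.extend_source_mem_nhds hf.mem_domChart_source
  have hψ : ContMDiffAt I' 𝓘(𝕜, E') n ψ (f x) :=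
    OpenPartialHomeomorph.contMDiffAt_extend hf.codChart_mem_maximalAtlas hf.mem_codChart_source
  have hφx : I '' hf.domChart.target ∈ 𝓝 (φ x) := by
    rw [← hf.domChart.extend_target']
    exact hf.domChart.isOpen_extend_target.mem_nhds (φ.map_source (mem_of_mem_nhds hx))
  have hφ : ContMDiffAt 𝓘(𝕜, E) I n φ.symm (φ x) :=
    (contMDiffOn_extend_symm hf.domChart_mem_maximalAtlas).contMDiffAt hφx
  refine ⟨fun p ↦ φ.symm (L (ψ p)),
    hφ.comp_of_eq (L.contMDiff.contMDiffAt.comp (f x) hψ) (hL (mem_of_mem_nhds hx)), ?_⟩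
  filter_upwards [hx] with y hy
  rw [hL hy, φ.left_inv hy]

variable [IsManifold I' 1 M']

theorem exists_extension_of_isImmersionAt [I.Boundaryless]
    (hf : Manifold.IsImmersionAt I I' n f x) (hn : n ≠ 0) {W : Π y : M, TangentSpace I' (f y)}
    (hW : MDifferentiableAt I I'.tangent (fun y ↦ (⟨f y, W y⟩ : TangentBundle I' M')) x) :
    ∃ W' : Π p : M', TangentSpace I' p, MDiffAt (T% W') (f x) ∧ ∀ᶠ y in 𝓝 x, W y = W' (f y) := by
  obtain ⟨r, hr, hrf⟩ := exists_leftInverse_of_isImmersionAt hf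
  let e := trivializationAt E' (TangentSpace I' : M' → Type _) (f x)
  have hbase : e.baseSet ∈ 𝓝 (f x) := e.open_baseSet.mem_nhds
    (FiberBundle.mem_baseSet_trivializationAt' (f x))
  refine ⟨fun p ↦ e.symm p (e ⟨f (r p), W (r p)⟩).2, ?_, ?_⟩
  · have hcoord : MDifferentiableAt I 𝓘(𝕜, E') (fun y ↦ (e ⟨f y, W y⟩).2) x :=
      ((mdifferentiableAt_totalSpace _ _).1 hW).2
    rw [mdifferentiableAt_section]
    refine (hcoord.comp_of_eq (f x) (hr.mdifferentiableAt hn)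
      hrf.self_of_nhds).congr_of_eventuallyEq ?_
    filter_upwards [hbase] with p hp
    rw [e.apply_mk_symm hp]
    rfl
  · filter_upwards [hrf, hf.contMDiffAt.continuousAt hbase] with y hry hfy
    rw [hry]
    exact (e.symm_apply_apply_mk hfy _).symm

theorem exists_lift_of_isImmersionAt [I.Boundaryless] [IsManifold I 1 M]
    (hf : Manifold.IsImmersionAt I I' n f x) (hn : 2 ≤ n) {W : Π y : M, TangentSpace I' (f y)}
    (hW : MDifferentiableAt I I'.tangent (fun y ↦ (⟨f y, W y⟩ : TangentBundle I' M')) x)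
    (hWf : ∀ᶠ y in 𝓝 x, W y ∈ Set.range (mfderiv I I' f y)) :
    ∃ V : Π y : M, TangentSpace I y, MDiffAt (T% V) x ∧
      ∀ᶠ y in 𝓝 x, mfderiv I I' f y (V y) = W y := by
  obtain ⟨r, hr, hrf⟩ := exists_leftInverse_of_isImmersionAt hf
  have hfd : ∀ᶠ y in 𝓝 x, MDifferentiableAt I I' f y :=
    eventually_mdifferentiableAt_of_contMDiffAt (hf.contMDiffAt.of_le (one_le_two.trans hn))
  have hrd : ∀ᶠ y in 𝓝 x, MDifferentiableAt I' I r (f y) :=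
    hf.contMDiffAt.continuousAt.eventually
      (eventually_mdifferentiableAt_of_contMDiffAt (hr.of_le (one_le_two.trans hn)))
  refine ⟨fun y ↦ (mfderiv I' I r (f y) (W y) : E), ?_, ?_⟩
  · refine (mdifferentiableAt_mfderiv_along (hr.of_le hn) hW).congr_of_eventuallyEq ?_
    filter_upwards [hrf] with y hry
    exact TotalSpace.ext hry.symm HEq.rfl
  · filter_upwards [hWf, hrf.eventually_nhds, hrd, hfd] with y ⟨u, hu⟩ hry hrdy hfdy
    have hleft : mfderiv I' I r (f y) (mfderiv I I' f y u) = u := by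
      have hid : r ∘ f =ᶠ[𝓝 y] id := hry
      have hd := hid.mfderiv_eq (I := I) (I' := I)
      rw [mfderiv_comp y hrdy hfdy, mfderiv_id] at hd
      exact DFunLike.congr_fun hd u
    rw [← hu]
    exact congrArg (mfderiv I I' f y) hleft

end RelatedVectorFields

section Gauss

instance instIsManifoldMinSmoothnessReal {E : Type*} [NormedAddCommGroup E] [NormedSpace ℝ E]
    {H : Type*} [TopologicalSpace H] {I : ModelWithCorners ℝ E H}
    {M : Type*} [TopologicalSpace M] [ChartedSpace H M] [IsManifold I 2 M] :
    IsManifold I (minSmoothness ℝ 2) M := by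
  simpa

variable {E : Type*} [NormedAddCommGroup E] [NormedSpace ℝ E]
  {M : Type*} [TopologicalSpace M] [ChartedSpace E M] [IsManifold 𝓘(ℝ, E) ∞ M]
  {g : SemiRiemannianMetric E M}
  {cov : CovariantDerivative 𝓘(ℝ, E) E (TangentSpace 𝓘(ℝ, E) : M → Type _)}

theorem IsLeviCivita.two_mul_inner_eq_koszul (h : IsLeviCivita g cov) {p : M}
    {X Y Z : Π p : M, TangentSpace 𝓘(ℝ, E) p}
    (hX : MDiffAt (T% X) p) (hY : MDiffAt (T% Y) p) (hZ : MDiffAt (T% Z) p) :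
    2 * g.inner p (cov Y p (X p)) (Z p) = g.koszul X Y Z p := by
  rw [SemiRiemannianMetric.koszul, h.metric _ hY hZ, h.metric _ hX hZ, h.metric _ hX hY,
    ← h.torsionFree hX hY, ← h.torsionFree hX hZ, ← h.torsionFree hY hZ]
  simp only [map_sub, sub_apply]
  rw [g.symm p (Y p), g.symm p (X p) (cov Z p _), g.symm p (X p) (cov Y p _)]
  ring

variable {F : Type*} [NormedAddCommGroup F] [NormedSpace ℝ F]
  {N : Type*} [TopologicalSpace N] [ChartedSpace F N] [IsManifold 𝓘(ℝ, F) ∞ N]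
  {g' : SemiRiemannianMetric F N}
  {cov' : CovariantDerivative 𝓘(ℝ, F) F (TangentSpace 𝓘(ℝ, F) : N → Type _)}
  {f : N → M} {x : N}
  {X Y Z : Π y : N, TangentSpace 𝓘(ℝ, F) y} {X' Y' Z' : Π p : M, TangentSpace 𝓘(ℝ, E) p}

theorem mvfderiv_inner_eq_of_mrelatedAt (hg : ∀ y, g'.inner y = pullbackInner g f y)
    (hf : MDifferentiableAt 𝓘(ℝ, F) 𝓘(ℝ, E) f x)
    (hY' : MDiffAt (T% Y') (f x)) (hZ' : MDiffAt (T% Z') (f x))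
    (hXX' : MRelatedAt 𝓘(ℝ, F) 𝓘(ℝ, E) f X X' x) (hYY' : MRelatedAt 𝓘(ℝ, F) 𝓘(ℝ, E) f Y Y' x)
    (hZZ' : MRelatedAt 𝓘(ℝ, F) 𝓘(ℝ, E) f Z Z' x) :
    d% (fun y ↦ g'.inner y (Y y) (Z y)) x (X x) =
      d% (fun p ↦ g.inner p (Y' p) (Z' p)) (f x) (X' (f x)) := by
  have hinner : (fun y ↦ g'.inner y (Y y) (Z y)) =ᶠ[𝓝 x]
      (fun p ↦ g.inner p (Y' p) (Z' p)) ∘ f := by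
    filter_upwards [hYY', hZZ'] with y hy hz
    rw [hg, pullbackInner_apply, hy, hz, Function.comp_apply]
  rw [← hXX'.mvfderiv_comp_apply (g.mdifferentiableAt_inner hY' hZ') hf]
  exact DFunLike.congr_fun hinner.mfderiv_eq (X x)

variable [CompleteSpace E] [CompleteSpace F]

theorem koszul_eq_of_mrelatedAt (hg : ∀ y, g'.inner y = pullbackInner g f y)
    (hf : ContMDiffAt 𝓘(ℝ, F) 𝓘(ℝ, E) 2 f x)
    (hX : MDiffAt (T% X) x) (hY : MDiffAt (T% Y) x) (hZ : MDiffAt (T% Z) x)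
    (hX' : MDiffAt (T% X') (f x)) (hY' : MDiffAt (T% Y') (f x)) (hZ' : MDiffAt (T% Z') (f x))
    (hXX' : MRelatedAt 𝓘(ℝ, F) 𝓘(ℝ, E) f X X' x) (hYY' : MRelatedAt 𝓘(ℝ, F) 𝓘(ℝ, E) f Y Y' x)
    (hZZ' : MRelatedAt 𝓘(ℝ, F) 𝓘(ℝ, E) f Z Z' x) :
    g'.koszul X Y Z x = g.koszul X' Y' Z' (f x) := by
  have hfd := hf.mdifferentiableAt two_ne_zero
  have hf2 : ContMDiffAt 𝓘(ℝ, F) 𝓘(ℝ, E) (minSmoothness ℝ 2) f x := by simpa using hf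
  rw [SemiRiemannianMetric.koszul, SemiRiemannianMetric.koszul,
    mvfderiv_inner_eq_of_mrelatedAt hg hfd hY' hZ' hXX' hYY' hZZ',
    mvfderiv_inner_eq_of_mrelatedAt hg hfd hX' hZ' hYY' hXX' hZZ',
    mvfderiv_inner_eq_of_mrelatedAt hg hfd hX' hY' hZZ' hXX' hYY']
  simp only [hg, pullbackInner_apply, hXX'.mfderiv_apply, hYY'.mfderiv_apply, hZZ'.mfderiv_apply,
    mfderiv_mlieBracket_of_mrelatedAt hf2 hX hY hX' hY' hXX' hYY',
    mfderiv_mlieBracket_of_mrelatedAt hf2 hX hZ hX' hZ' hXX' hZZ',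
    mfderiv_mlieBracket_of_mrelatedAt hf2 hY hZ hY' hZ' hYY' hZZ']

theorem IsLeviCivita.inner_eq_inner_mfderiv (h' : IsLeviCivita g' cov') (h : IsLeviCivita g cov)
    (hg : ∀ y, g'.inner y = pullbackInner g f y)
    {n : ℕ∞ω} (hf : Manifold.IsImmersionAt 𝓘(ℝ, F) 𝓘(ℝ, E) n f x) (hn : 2 ≤ n)
    (hX : MDiffAt (T% X) x) (hY : MDiffAt (T% Y) x)
    (hX' : MDiffAt (T% X') (f x)) (hY' : MDiffAt (T% Y') (f x))
    (hXX' : MRelatedAt 𝓘(ℝ, F) 𝓘(ℝ, E) f X X' x) (hYY' : MRelatedAt 𝓘(ℝ, F) 𝓘(ℝ, E) f Y Y' x)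
    (u : TangentSpace 𝓘(ℝ, F) x) :
    g'.inner x (cov' Y x (X x)) u =
      g.inner (f x) (cov Y' (f x) (X' (f x))) (mfderiv 𝓘(ℝ, F) 𝓘(ℝ, E) f x u) := by
  have hf2 : ContMDiffAt 𝓘(ℝ, F) 𝓘(ℝ, E) 2 f x := hf.contMDiffAt.of_le hn
  have hZ := FiberBundle.mdifferentiableAt_extend (I := 𝓘(ℝ, F)) (F := F) u
  obtain ⟨Z', hZ', hZZ'⟩ := exists_extension_of_isImmersionAt hf (two_pos.trans_le hn).ne'
    (mdifferentiableAt_mfderiv_along (f := id) hf2 hZ)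
  have hkoszul := koszul_eq_of_mrelatedAt hg hf2 hX hY hZ hX' hY' hZ' hXX' hYY' hZZ'
  rw [← h'.two_mul_inner_eq_koszul hX hY hZ, ← h.two_mul_inner_eq_koszul hX' hY' hZ',
    ← hZZ'.self_of_nhds, FiberBundle.extend_apply_self] at hkoszul
  exact mul_left_cancel₀ two_ne_zero hkoszul

theorem IsLeviCivita.inner_comm_of_normal (h : IsLeviCivita g cov)
    (hf : ContMDiffAt 𝓘(ℝ, F) 𝓘(ℝ, E) 2 f x)
    (hX : MDiffAt (T% X) x) (hY : MDiffAt (T% Y) x)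
    (hX' : MDiffAt (T% X') (f x)) (hY' : MDiffAt (T% Y') (f x))
    (hXX' : MRelatedAt 𝓘(ℝ, F) 𝓘(ℝ, E) f X X' x) (hYY' : MRelatedAt 𝓘(ℝ, F) 𝓘(ℝ, E) f Y Y' x)
    {ν : TangentSpace 𝓘(ℝ, E) (f x)}
    (hν : ∀ w, g.inner (f x) (mfderiv 𝓘(ℝ, F) 𝓘(ℝ, E) f x w) ν = 0) :
    g.inner (f x) (cov Y' (f x) (X' (f x))) ν = g.inner (f x) (cov X' (f x) (Y' (f x))) ν := by
  have hbracket := hν (mlieBracket 𝓘(ℝ, F) X Y x)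
  rw [mfderiv_mlieBracket_of_mrelatedAt (by simpa using hf) hX hY hX' hY' hXX' hYY',
    ← h.torsionFree hX' hY', map_sub, sub_apply] at hbracket
  exact sub_eq_zero.1 hbracket

end Gauss

section CRSubmanifold

theorem paraSign_ne_zero (α : Fin 3) : paraSign α ≠ 0 := by
  fin_cases α <;> simp [paraSign]

variable {E : Type*} [NormedAddCommGroup E] [NormedSpace ℝ E]
  {M : Type*} [TopologicalSpace M] [ChartedSpace E M] [IsManifold 𝓘(ℝ, E) ∞ M]
  {g : SemiRiemannianMetric E M} {σ : AlmostParaquaternionicStructure E M}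
  {cov : CovariantDerivative 𝓘(ℝ, E) E (TangentSpace 𝓘(ℝ, E) : M → Type _)}
  {U : Set M} {J : Fin 3 → Π p : M, TangentSpace 𝓘(ℝ, E) p →L[ℝ] TangentSpace 𝓘(ℝ, E) p}

theorem IsCanonicalLocalBasis.mem_fiber (hJ : IsCanonicalLocalBasis σ.fiber U J) {p : M}
    (hp : p ∈ U) (α : Fin 3) : J α p ∈ σ.fiber p := by
  rw [hJ.span_eq p hp]
  exact Submodule.subset_span ⟨α, rfl⟩

theorem IsCanonicalLocalBasis.mdifferentiableAt (hU : IsOpen U)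
    (hJ : IsCanonicalLocalBasis σ.fiber U J) {p : M} (hp : p ∈ U) (α : Fin 3) :
    MDifferentiableAt 𝓘(ℝ, E) (𝓘(ℝ, E).prod 𝓘(ℝ, E →L[ℝ] E))
      (fun x ↦ TotalSpace.mk' (E →L[ℝ] E)
        (E := fun x : M ↦ TangentSpace 𝓘(ℝ, E) x →L[ℝ] TangentSpace 𝓘(ℝ, E) x) x (J α x)) p :=
  ((hJ.contMDiffOn α).contMDiffAt (hU.mem_nhds hp)).mdifferentiableAt (by simp)

theorem IsAdapted.inner_apply_right (hg : IsAdapted g σ) (hU : IsOpen U)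
    (hJ : IsCanonicalLocalBasis σ.fiber U J) {p : M} (hp : p ∈ U) (α : Fin 3)
    (v w : TangentSpace 𝓘(ℝ, E) p) :
    g.inner p v (J α p w) = -g.inner p (J α p v) w := by
  apply mul_left_cancel₀ (paraSign_ne_zero α)
  rw [← hg U J hU hJ p hp, hJ.sq p hp, map_smul, smul_eq_mul, neg_mul_comm]

/-- As `σ` is parallel, `(∇_v J_α) X` lies in the span of `σ X`, hence in `V`. -/
theorem IsParallel.inner_covariantDerivative_apply (hσ : IsParallel cov σ) (hU : IsOpen U)
    (hJ : IsCanonicalLocalBasis σ.fiber U J) (α : Fin 3) {p : M} (hp : p ∈ U)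
    {V : Submodule ℝ (TangentSpace 𝓘(ℝ, E) p)} (hV : ∀ T ∈ σ.fiber p, ∀ v ∈ V, T v ∈ V)
    {X : Π p : M, TangentSpace 𝓘(ℝ, E) p} (hX : MDiffAt (T% X) p) (hXV : X p ∈ V)
    {ν : TangentSpace 𝓘(ℝ, E) p} (hν : ∀ w ∈ V, g.inner p w ν = 0) (v : TangentSpace 𝓘(ℝ, E) p) :
    g.inner p (cov (fun y ↦ J α y (X y)) p v) ν = g.inner p (J α p (cov X p v)) ν := by
  obtain ⟨T, hT, hTX⟩ :=
    hσ U (J α) hU (fun _ hy ↦ hJ.mem_fiber hy α) (hJ.contMDiffOn α) p hp v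
  have hzero := hν _ (hV T hT _ hXV)
  rw [hTX X hX, map_sub, sub_apply] at hzero
  exact sub_eq_zero.1 hzero

theorem IsParallel.paraSign_mul_inner_self_eq_neg (hσ : IsParallel cov σ) (hg : IsAdapted g σ)
    (hU : IsOpen U) (hJ : IsCanonicalLocalBasis σ.fiber U J) (α : Fin 3) {p : M} (hp : p ∈ U)
    {V : Submodule ℝ (TangentSpace 𝓘(ℝ, E) p)} (hV : ∀ T ∈ σ.fiber p, ∀ v ∈ V, T v ∈ V)
    {X : Π p : M, TangentSpace 𝓘(ℝ, E) p} (hX : MDiffAt (T% X) p) (hXV : X p ∈ V)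
    {ν : TangentSpace 𝓘(ℝ, E) p} (hν : ∀ w ∈ V, g.inner p w ν = 0)
    (hJν : ∀ w ∈ V, g.inner p w (J α p ν) = 0)
    (hcomm : g.inner p (cov (fun y ↦ J α y (X y)) p (X p)) (J α p ν) =
      g.inner p (cov X p (J α p (X p))) (J α p ν)) :
    paraSign α * g.inner p (cov X p (X p)) ν =
      -g.inner p (cov (fun y ↦ J α y (X y)) p (J α p (X p))) ν :=
  calc paraSign α * g.inner p (cov X p (X p)) ν
      = g.inner p (J α p (cov X p (X p))) (J α p ν) := (hg U J hU hJ p hp α _ _).symm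
    _ = g.inner p (cov (fun y ↦ J α y (X y)) p (X p)) (J α p ν) :=
        (hσ.inner_covariantDerivative_apply hU hJ α hp hV hX hXV hJν _).symm
    _ = g.inner p (cov X p (J α p (X p))) (J α p ν) := hcomm
    _ = -g.inner p (J α p (cov X p (J α p (X p)))) ν := hg.inner_apply_right hU hJ hp α _ _
    _ = -g.inner p (cov (fun y ↦ J α y (X y)) p (J α p (X p))) ν := by
        rw [hσ.inner_covariantDerivative_apply hU hJ α hp hV hX hXV hν]

theorem SemiRiemannianMetric.bilin_nondegenerate (g : SemiRiemannianMetric E M) (p : M) :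
    (g.bilin p).Nondegenerate :=
  (g.bilin_isSymm p).isRefl.nondegenerate_iff_separatingLeft.2 (g.nondegenerate p)

theorem TangentDistribution.secondFundamentalForm_eq_zero_iff [FiniteDimensional ℝ E]
    {D : TangentDistribution E M} (hD : D.IsNondegenerate g)
    {X Y : Π p : M, TangentSpace 𝓘(ℝ, E) p} {p : M} :
    D.secondFundamentalForm hD X Y p = 0 ↔
      ∀ u ∈ D.orthogonal g p, g.inner p (g.leviCivita Y p (X p)) u = 0 := by
  rw [secondFundamentalForm, Submodule.projection_apply_eq_zero_iff]
  conv_lhs => rw [← LinearMap.BilinForm.orthogonal_orthogonal (g.bilin_nondegenerate p)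
    (g.bilin_isSymm p).isRefl (D.fiber p)]
  exact forall₂_congr fun u _ ↦ by rw [g.symm]; rfl

variable {F : Type*} [NormedAddCommGroup F] [NormedSpace ℝ F]
  {N : Type*} [TopologicalSpace N] [ChartedSpace F N]
  {f : N → M} {hf : IsNondegenerateImmersion (F := F) g f}

theorem IsNondegenerateImmersion.mfderiv_injective (hf : IsNondegenerateImmersion (F := F) g f)
    (x : N) : Function.Injective (mfderiv 𝓘(ℝ, F) 𝓘(ℝ, E) f x) :=
  (injective_iff_map_eq_zero _).2 fun v hv ↦ hf.nondegenerate x v fun w ↦ by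
    rw [hv, map_zero, zero_apply]

theorem IsNondegenerateImmersion.contMDiffAt_two (hf : IsNondegenerateImmersion (F := F) g f)
    (x : N) : ContMDiffAt 𝓘(ℝ, F) 𝓘(ℝ, E) 2 f x :=
  (hf.isImmersion.contMDiff x).of_le ENat.LEInfty.out

variable [IsManifold 𝓘(ℝ, F) ∞ N] {D : TangentDistribution F N} {x : N}

namespace IsParaquaternionicCRSubmanifold

theorem apply_mem_map_mfderiv (hD : IsParaquaternionicCRSubmanifold g σ hf D)
    {T : TangentSpace 𝓘(ℝ, E) (f x) →L[ℝ] TangentSpace 𝓘(ℝ, E) (f x)} (hT : T ∈ σ.fiber (f x))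
    {v : TangentSpace 𝓘(ℝ, E) (f x)}
    (hv : v ∈ (D.fiber x).map (mfderiv 𝓘(ℝ, F) 𝓘(ℝ, E) f x).toLinearMap) :
    T v ∈ (D.fiber x).map (mfderiv 𝓘(ℝ, F) 𝓘(ℝ, E) f x).toLinearMap := by
  obtain ⟨U, hU, hx, J, hJ⟩ := σ.exists_basis (f x)
  rw [hJ.span_eq _ hx] at hT
  induction hT using Submodule.span_induction with
  | mem T hT =>
    obtain ⟨α, rfl⟩ := hT
    rw [← hD.paraquaternionic U J hU hJ x hx α]
    exact Submodule.mem_map_of_mem hv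
  | zero => exact Submodule.zero_mem _
  | add T T' _ _ h h' => exact Submodule.add_mem _ h h'
  | smul c T _ h => exact Submodule.smul_mem _ c h

theorem exists_mfderiv_eq_apply (hD : IsParaquaternionicCRSubmanifold g σ hf D) (hU : IsOpen U)
    (hJ : IsCanonicalLocalBasis σ.fiber U J) (hx : f x ∈ U) (α : Fin 3)
    {X : Π y : N, TangentSpace 𝓘(ℝ, F) y} (hX : MDiffAt (T% X) x)
    (hXD : ∀ᶠ y in 𝓝 x, X y ∈ D.fiber y) :
    ∃ Y : Π y : N, TangentSpace 𝓘(ℝ, F) y, MDiffAt (T% Y) x ∧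
      (∀ᶠ y in 𝓝 x, Y y ∈ D.fiber y) ∧
      ∀ᶠ y in 𝓝 x, mfderiv 𝓘(ℝ, F) 𝓘(ℝ, E) f y (Y y) =
        J α (f y) (mfderiv 𝓘(ℝ, F) 𝓘(ℝ, E) f y (X y)) := by
  have hfx := hf.isImmersion.isImmersionAt x
  have hfx2 := hf.contMDiffAt_two x
  have hJXD : ∀ᶠ y in 𝓝 x, J α (f y) (mfderiv 𝓘(ℝ, F) 𝓘(ℝ, E) f y (X y)) ∈
      (D.fiber y).map (mfderiv 𝓘(ℝ, F) 𝓘(ℝ, E) f y).toLinearMap := by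
    filter_upwards [hfx2.continuousAt (hU.mem_nhds hx), hXD] with y hy hXy
    exact hD.apply_mem_map_mfderiv (hJ.mem_fiber hy α) (Submodule.mem_map_of_mem hXy)
  have hJX : MDifferentiableAt 𝓘(ℝ, F) 𝓘(ℝ, E).tangent (fun y ↦
      (⟨f y, J α (f y) (mfderiv 𝓘(ℝ, F) 𝓘(ℝ, E) f y (X y))⟩ : TangentBundle 𝓘(ℝ, E) M)) x :=
    MDifferentiableAt.clm_bundle_apply (F₁ := E) (F₂ := E)
      (E₁ := (TangentSpace 𝓘(ℝ, E) : M → Type _)) (E₂ := (TangentSpace 𝓘(ℝ, E) : M → Type _))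
      (b := f) (ϕ := fun y ↦ J α (f y)) (v := fun y ↦ mfderiv 𝓘(ℝ, F) 𝓘(ℝ, E) f y (X y))
      ((hJ.mdifferentiableAt hU hx α).comp x (hfx2.mdifferentiableAt two_ne_zero))
      (mdifferentiableAt_mfderiv_along (f := id) hfx2 hX)
  obtain ⟨Y, hY, hYJX⟩ := exists_lift_of_isImmersionAt hfx ENat.LEInfty.out hJX
    (hJXD.mono fun y ⟨w, _, hw⟩ ↦ ⟨w, hw⟩)
  refine ⟨Y, hY, ?_, hYJX⟩
  filter_upwards [hJXD, hYJX] with y ⟨w, hwD, hw⟩ hy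
  rwa [hf.mfderiv_injective y (hy.trans hw.symm)]

section

variable [CompleteSpace E] [CompleteSpace F]
  {cov' : CovariantDerivative 𝓘(ℝ, F) F (TangentSpace 𝓘(ℝ, F) : N → Type _)}

theorem paraSign_mul_inner_eq_neg (hD : IsParaquaternionicCRSubmanifold g σ hf D)
    (hcov' : IsLeviCivita (inducedMetric g hf) cov') (hcov : IsLeviCivita g cov)
    (hg : IsAdapted g σ) (hσ : IsParallel cov σ)
    (hU : IsOpen U) (hJ : IsCanonicalLocalBasis σ.fiber U J) (hx : f x ∈ U) (α : Fin 3)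
    {X Y : Π y : N, TangentSpace 𝓘(ℝ, F) y} (hX : MDiffAt (T% X) x) (hY : MDiffAt (T% Y) x)
    (hXD : X x ∈ D.fiber x)
    (hXY : ∀ᶠ y in 𝓝 x, mfderiv 𝓘(ℝ, F) 𝓘(ℝ, E) f y (Y y) =
      J α (f y) (mfderiv 𝓘(ℝ, F) 𝓘(ℝ, E) f y (X y)))
    {u : TangentSpace 𝓘(ℝ, F) x} (hu : u ∈ D.orthogonal (inducedMetric g hf) x) :
    paraSign α * (inducedMetric g hf).inner x (cov' X x (X x)) u =
      -(inducedMetric g hf).inner x (cov' Y x (Y x)) u := by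
  have hfx := hf.isImmersion.isImmersionAt x
  have hfx2 := hf.contMDiffAt_two x
  obtain ⟨X', hX', hX'X⟩ := exists_extension_of_isImmersionAt hfx (by simp)
    (mdifferentiableAt_mfderiv_along (f := id) hfx2 hX)
  have hXX' : MRelatedAt 𝓘(ℝ, F) 𝓘(ℝ, E) f X X' x := hX'X
  let Y' : Π p : M, TangentSpace 𝓘(ℝ, E) p := fun p ↦ J α p (X' p)
  have hY' : MDiffAt (T% Y') (f x) := (hJ.mdifferentiableAt hU hx α).clm_bundle_apply hX'
  have hYY' : MRelatedAt 𝓘(ℝ, F) 𝓘(ℝ, E) f Y Y' x := by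
    filter_upwards [hXY, hXX'] with y hYy hXy
    rw [hYy, hXy]
  have hJu (w : TangentSpace 𝓘(ℝ, F) x) : g.inner (f x) (mfderiv 𝓘(ℝ, F) 𝓘(ℝ, E) f x w)
      (J α (f x) (mfderiv 𝓘(ℝ, F) 𝓘(ℝ, E) f x u)) = 0 :=
    (g.symm _ _ _).trans (hD.totallyReal U J hU hJ x hx α u hu w)
  rw [hcov'.inner_eq_inner_mfderiv hcov (fun _ ↦ rfl) hfx ENat.LEInfty.out hX hX hX' hX' hXX' hXX',
    hcov'.inner_eq_inner_mfderiv hcov (fun _ ↦ rfl) hfx ENat.LEInfty.out hY hY hY' hY' hYY' hYY']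
  refine hσ.paraSign_mul_inner_self_eq_neg hg hU hJ α hx
    (V := (D.fiber x).map (mfderiv 𝓘(ℝ, F) 𝓘(ℝ, E) f x).toLinearMap)
    (fun T hT v hv ↦ hD.apply_mem_map_mfderiv hT hv) hX' ⟨X x, hXD, hXX'.mfderiv_apply⟩ ?_ ?_
    (hcov.inner_comm_of_normal hfx2 hX hY hX' hY' hXX' hYY' hJu)
  · rintro _ ⟨w, hw, rfl⟩
    exact hu w hw
  · rintro _ ⟨w, -, rfl⟩
    exact hJu w

theorem inner_covariantDerivative_self_eq_zero (hD : IsParaquaternionicCRSubmanifold g σ hf D)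
    (hcov' : IsLeviCivita (inducedMetric g hf) cov') (hcov : IsLeviCivita g cov)
    (hg : IsAdapted g σ) (hσ : IsParallel cov σ)
    {X : Π y : N, TangentSpace 𝓘(ℝ, F) y} (hX : MDiffAt (T% X) x)
    (hXD : ∀ᶠ y in 𝓝 x, X y ∈ D.fiber y)
    {u : TangentSpace 𝓘(ℝ, F) x} (hu : u ∈ D.orthogonal (inducedMetric g hf) x) :
    (inducedMetric g hf).inner x (cov' X x (X x)) u = 0 := by
  obtain ⟨U, hU, hx, J, hJ⟩ := σ.exists_basis (f x)
  obtain ⟨Y, hY, hYD, hXY⟩ := hD.exists_mfderiv_eq_apply hU hJ hx 2 hX hXD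
  obtain ⟨Z, hZ, -, hXZ⟩ := hD.exists_mfderiv_eq_apply hU hJ hx 0 hX hXD
  have hYZ : ∀ᶠ y in 𝓝 x, mfderiv 𝓘(ℝ, F) 𝓘(ℝ, E) f y (Z y) =
      J 1 (f y) (mfderiv 𝓘(ℝ, F) 𝓘(ℝ, E) f y (Y y)) := by
    filter_upwards [hXY, hXZ,
      (hf.contMDiffAt_two x).continuousAt (hU.mem_nhds hx)] with y hYy hZy hy
    have hmul := hJ.mul (f y) hy 1 (mfderiv 𝓘(ℝ, F) 𝓘(ℝ, E) f y (X y))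
    rw [hYy, hZy]
    simpa [paraSign] using hmul.symm
  have hXY_neg := hD.paraSign_mul_inner_eq_neg hcov' hcov hg hσ hU hJ hx 2 hX hY
    hXD.self_of_nhds hXY hu
  have hYZ_neg := hD.paraSign_mul_inner_eq_neg hcov' hcov hg hσ hU hJ hx 1 hY hZ
    hYD.self_of_nhds hYZ hu
  have hXZ_neg := hD.paraSign_mul_inner_eq_neg hcov' hcov hg hσ hU hJ hx 0 hX hZ
    hXD.self_of_nhds hXZ hu
  simp only [paraSign, Matrix.cons_val] at hXY_neg hYZ_neg hXZ_neg
  linarith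

end

variable [FiniteDimensional ℝ E] [FiniteDimensional ℝ F]

theorem secondFundamentalForm_self_eq_zero (hD : IsParaquaternionicCRSubmanifold g σ hf D)
    (hM : IsParaquaternionicKahler g σ)
    {X : Π y : N, TangentSpace 𝓘(ℝ, F) y} (hX : MDiffAt (T% X) x)
    (hXD : ∀ᶠ y in 𝓝 x, X y ∈ D.fiber y) :
    TangentDistribution.secondFundamentalForm hD.nondegenerate X X x = 0 := by
  have : CompleteSpace E := FiniteDimensional.complete ℝ E
  have : CompleteSpace F := FiniteDimensional.complete ℝ F
  exact (TangentDistribution.secondFundamentalForm_eq_zero_iff _).2 fun u hu ↦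
    hD.inner_covariantDerivative_self_eq_zero (inducedMetric g hf).isLeviCivita_leviCivita
      g.isLeviCivita_leviCivita hM.adapted hM.parallel hX hXD hu

end IsParaquaternionicCRSubmanifold

end CRSubmanifold

theorem mainTheorem3
    {E : Type*} [NormedAddCommGroup E] [NormedSpace ℝ E] [FiniteDimensional ℝ E]
    {M : Type*} [TopologicalSpace M] [ChartedSpace E M] [IsManifold 𝓘(ℝ, E) ∞ M]
    {F : Type*} [NormedAddCommGroup F] [NormedSpace ℝ F] [FiniteDimensional ℝ F]
    {N : Type*} [TopologicalSpace N] [ChartedSpace F N] [IsManifold 𝓘(ℝ, F) ∞ N]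
    (g : SemiRiemannianMetric E M) (σ : AlmostParaquaternionicStructure E M)
    (hM : IsParaquaternionicKahler g σ)
    (f : N → M) (hf : IsNondegenerateImmersion (F := F) g f)
    (D : TangentDistribution F N) (hD : IsParaquaternionicCRSubmanifold g σ hf D) :
    TangentDistribution.IsMinimal hD.nondegenerate ∧
      ∀ (U : Set N) (X : Π x : N, TangentSpace 𝓘(ℝ, F) x), IsOpen U → D.IsSectionOn U X →
        ∀ x ∈ U, TangentDistribution.secondFundamentalForm hD.nondegenerate X X x = 0 := by
  have secondFundamentalForm_self_eq_zero (U : Set N) (X : Π x : N, TangentSpace 𝓘(ℝ, F) x)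
      (hU : IsOpen U) (hX : D.IsSectionOn U X) (x : N) (hx : x ∈ U) :
      TangentDistribution.secondFundamentalForm hD.nondegenerate X X x = 0 :=
    hD.secondFundamentalForm_self_eq_zero hM
      ((hX.contMDiffOn.contMDiffAt (hU.mem_nhds hx)).mdifferentiableAt (by simp))
      (Filter.eventually_of_mem (hU.mem_nhds hx) hX.mem)
  refine ⟨fun x U hU hx q e he _ ↦ ?_, secondFundamentalForm_self_eq_zero⟩
  simp [TangentDistribution.meanCurvatureVector,
    secondFundamentalForm_self_eq_zero U _ hU (he _) x hx]
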